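/- Let $d\ge 1$ be an integer, $\sigma>0$, $\theta=(\theta_1,\dots,\theta_d)\in\mathbb R^d$, and let $\mathbf P_\theta$ (with expectation $\mathbf E_\theta$) be the law of the observations $y_j=\theta_j+\sigma\xi_j$, $j=1,\dots,d$, where $\xi_1,\dots,\xi_d$ are i.i.d. standard normal random variables. Let $L(\theta)=\sum_{i=1}^d\theta_i$. For an integer $1\le s\le d$ let $B_0(s)$ be the set of $\theta\in\mathbb R^d$ with at most $s$ non-zero components, and set $$\psi_\sigma^L(s,d)=\sigma^2s^2\log(1+d/s^2),\qquad R_L^*(B_0(s))=\inf_{\hat T}\sup_{\theta\in B_0(s)}\mathbf E_\theta(\hat T-L(\theta))^2,$$ where the infimum is over all estimators, that is, all measurable real-valued functions $\hat T$ of $(y_1,\dots,y_d)$. Let $$\hat L=\begin{cases}\sum_{j=1}^d y_j\,\mathbf 1_{\{|y_j|>\sigma\sqrt{2\log(1+d/s^2)}\}} & \text{if } s<\sqrt d,\\ \sum_{j=1}^d y_j & \text{if } s\ge\sqrt d.\end{cases}$$ There exist absolute constants $c>0$ and $C>0$ such that, for all integers $s,d$ with $1\le s\le d$ and all $\sigma>0$,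 the function $\hat L$ is an estimator (it is measurable) and $$\sup_{\theta\in B_0(s)}\mathbf E_\theta(\hat L-L(\theta))^2\le C\,\psi_\sigma^L(s,d),$$ $$c\,\psi_\sigma^L(s,d)\le R_L^*(B_0(s))\le C\,\psi_\sigma^L(s,d).$$ Moreover, with the same constants, for all such $s,d,\sigma$, $$c\,\min\bigl(\psi_\sigma^L(s,d),\sigma^2d\bigr)\le\psi_\sigma^L(s,d)\le C\,\min\bigl(\psi_\sigma^L(s,d),\sigma^2d\bigr),$$ $$c\,\min\bigl(\psi_\sigma^L(s,d),\sigma^2d\bigr)\le R_L^*(B_0(s))\le C\,\min\bigl(\psi_\sigma^L(s,d),\sigma^2d\bigr).$$ -/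

import Mathlib

open MeasureTheory ProbabilityTheory
open scoped ENNReal

noncomputable section

namespace SparseSequence

/-- The law `P_θ` of the observations `y_j = θ_j + σ ξ_j`, `j = 1, …, d`, where the `ξ_j` are
i.i.d. standard normal random variables. -/
def obsLaw {d : ℕ} (σ : ℝ) (θ : Fin d → ℝ) : Measure (Fin d → ℝ) :=
  (Measure.pi fun _ : Fin d => gaussianReal 0 1).map fun ξ j => θ j + σ * ξ j

/-- The linear functional `L(θ) = ∑ θ_i`. -/
def linFun {d : ℕ} (θ : Fin d → ℝ) : ℝ := ∑ i, θ i

/-- The class `B_0(s)` of vectors in `ℝ^d` with at most `s` non-zero components. -/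
def sparseClass (d s : ℕ) : Set (Fin d → ℝ) := {θ | hammingNorm θ ≤ s}

/-- The maximum squared risk `sup_{θ ∈ Θ} E_θ (That - T(θ))²`, with values in `[0, ∞]`. -/
def maxRisk {d : ℕ} (σ : ℝ) (T : (Fin d → ℝ) → ℝ) (Θ : Set (Fin d → ℝ))
    (That : (Fin d → ℝ) → ℝ) : ℝ≥0∞ :=
  ⨆ θ ∈ Θ, ∫⁻ y, ENNReal.ofReal ((That y - T θ) ^ 2) ∂(obsLaw σ θ)

/-- The minimax squared risk `R*_T(Θ)`: the infimum of the maximum squared risk over all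
estimators, i.e. all measurable real-valued functions of the observations. -/
def minimaxSqRisk {d : ℕ} (σ : ℝ) (T : (Fin d → ℝ) → ℝ) (Θ : Set (Fin d → ℝ)) : ℝ≥0∞ :=
  ⨅ (That : (Fin d → ℝ) → ℝ) (_ : Measurable That), maxRisk σ T Θ That

/-- The rate `ψ = σ² s² log (1 + d / s²)`. -/
def linRate (σ : ℝ) (s d : ℕ) : ℝ :=
  σ ^ 2 * (s : ℝ) ^ 2 * Real.log (1 + (d : ℝ) / (s : ℝ) ^ 2)

open Classical in
/-- The estimator of the linear functional: hard thresholding at the level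
`σ √(2 log (1 + d / s²))` if `s < √d`, and the sum of all observations if `s ≥ √d`. -/
def linEstimator {d : ℕ} (σ : ℝ) (s : ℕ) (y : Fin d → ℝ) : ℝ :=
  if (s : ℝ) < √(d : ℝ) then
    ∑ j, if σ * √(2 * Real.log (1 + (d : ℝ) / (s : ℝ) ^ 2)) < |y j| then y j else 0
  else ∑ j, y j

end SparseSequence

end

/-! Upper bound. For `s ≥ √d` the unbiased sum has risk `σ² d`, which is of order `linRate` because
`log (1 + t) ≥ t / 2` on `[0, 1]`. For `s < √d`, threshold at `σ x`. Each of the at most `s` support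
coordinates errs by order `σ x`, and these errors may add up, giving `σ² s² x²`. Off the support the
kept noise is centred and independent, so variances add, giving about `σ² d x² exp (-x² / 2)`. The
choice `x² = 2 log (1 + d / s²)` balances the two (`lintegral_hardThreshold_sum_le`).

Lower bound. Test `θ = 0` against a uniform mixture of `s`-sparse vectors with equal entries `σ b`,
on which the functional is constantly `σ s b`. If the mixture has bounded second moment relative to
the null law, no estimator can do well under both (`two_hypotheses_lower_bound`). Choosing one
coordinate independently in each of `s` disjoint blocks makes this second moment a product over
blocks (`sum_exp_blockVector`), bounded when `b² = log (1 + d / s²)`. -/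

namespace SparseSequence

/-! ### Change of measure for Gaussian shifts -/

/-- The standard Gaussian law on `ℝ^ι`. -/
noncomputable abbrev stdGaussianPi (ι : Type*) [Fintype ι] : Measure (ι → ℝ) :=
  Measure.pi fun _ : ι => gaussianReal 0 1

/-- The density of the standard Gaussian law shifted by `h`, relative to the unshifted one. -/
noncomputable def shiftDensity {ι : Type*} [Fintype ι] (h x : ι → ℝ) : ℝ :=
  Real.exp (∑ i, (h i * x i - h i ^ 2 / 2))

lemma shiftDensity_pos {ι : Type*} [Fintype ι] (h x : ι → ℝ) : 0 < shiftDensity h x :=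
  Real.exp_pos _

lemma measurable_shiftDensity {ι : Type*} [Fintype ι] (h : ι → ℝ) :
    Measurable (shiftDensity h) := by
  unfold shiftDensity
  fun_prop

lemma gaussianReal_eq_withDensity_std (h : ℝ) :
    gaussianReal h 1 =
      (gaussianReal 0 1).withDensity fun x => ENNReal.ofReal (Real.exp (h * x - h ^ 2 / 2)) := by
  rw [gaussianReal_of_var_ne_zero _ one_ne_zero, gaussianReal_of_var_ne_zero _ one_ne_zero,
    ← withDensity_mul _ (measurable_gaussianPDF 0 1) (by fun_prop)]
  congr 1
  ext x
  simp only [gaussianPDF, Pi.mul_apply]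
  rw [← ENNReal.ofReal_mul (gaussianPDFReal_nonneg _ _ _)]
  congr 1
  simp only [gaussianPDFReal]
  rw [mul_assoc (√_)⁻¹ (Real.exp _) (Real.exp _), ← Real.exp_add]
  congr 2
  simp only [NNReal.coe_one]
  ring

lemma lintegral_prod_pi {ι : Type*} [Fintype ι] {Ω : ι → Type*} [∀ i, MeasurableSpace (Ω i)]
    (μ : ∀ i, Measure (Ω i)) [∀ i, IsProbabilityMeasure (μ i)] (f : ∀ i, Ω i → ℝ≥0∞)
    (hf : ∀ i, Measurable (f i)) :
    ∫⁻ x, ∏ i, f i (x i) ∂(Measure.pi μ) = ∏ i, ∫⁻ x, f i x ∂(μ i) := by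
  rw [lintegral_prod_eq_prod_lintegral_of_indepFun Finset.univ (fun i (x : ∀ i, Ω i) => f i (x i))
    (iIndepFun_pi fun i => (hf i).aemeasurable) fun i => (hf i).comp (measurable_pi_apply i)]
  refine Finset.prod_congr rfl fun i _ => ?_
  exact (measurePreserving_eval μ i).lintegral_comp (hf i)

lemma pi_gaussianReal_eq_withDensity {ι : Type*} [Fintype ι] (h : ι → ℝ) :
    Measure.pi (fun i => gaussianReal (h i) 1) =
      (stdGaussianPi ι).withDensity fun x => ENNReal.ofReal (shiftDensity h x) := by
  refine Measure.pi_eq fun s hs => ?_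
  rw [withDensity_apply _ (MeasurableSet.univ_pi hs),
    ← lintegral_indicator (MeasurableSet.univ_pi hs)]
  have key : ∀ x : ι → ℝ, (Set.univ.pi s).indicator
      (fun x => ENNReal.ofReal (shiftDensity h x)) x =
      ∏ i, (s i).indicator (fun t => ENNReal.ofReal (Real.exp (h i * t - h i ^ 2 / 2))) (x i) := by
    intro x
    by_cases hx : x ∈ Set.univ.pi s
    · rw [Set.indicator_of_mem hx, shiftDensity, Real.exp_sum,
        ENNReal.ofReal_prod_of_nonneg fun i _ => (Real.exp_pos _).le]
      refine Finset.prod_congr rfl fun i _ => ?_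
      rw [Set.indicator_of_mem (hx i trivial)]
    · rw [Set.indicator_of_notMem hx]
      simp only [Set.mem_univ_pi, not_forall] at hx
      obtain ⟨i, hi⟩ := hx
      exact (Finset.prod_eq_zero (Finset.mem_univ i) (Set.indicator_of_notMem hi _)).symm
  simp_rw [key]
  rw [lintegral_prod_pi (fun _ => gaussianReal 0 1) _
    fun i => Measurable.indicator (by fun_prop) (hs i)]
  refine Finset.prod_congr rfl fun i _ => ?_
  rw [lintegral_indicator (hs i), ← withDensity_apply _ (hs i), ← gaussianReal_eq_withDensity_std]

/-- Change of measure under a shift of the standard Gaussian law. -/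
lemma lintegral_shift {ι : Type*} [Fintype ι] (h : ι → ℝ) {g : (ι → ℝ) → ℝ≥0∞}
    (hg : Measurable g) :
    ∫⁻ x, g (fun i => h i + x i) ∂(stdGaussianPi ι) =
      ∫⁻ x, ENNReal.ofReal (shiftDensity h x) * g x ∂(stdGaussianPi ι) := by
  have h1 : Measurable fun x : ι → ℝ => fun i => h i + x i := by fun_prop
  rw [← lintegral_map hg h1]
  have h2 : (stdGaussianPi ι).map (fun x i => h i + x i) =
      Measure.pi (fun i => gaussianReal (h i) 1) := by
    rw [stdGaussianPi, Measure.pi_map_pi (f := fun i t => h i + t) fun i => by fun_prop]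
    congr 1
    ext1 i
    rw [gaussianReal_map_const_add, zero_add]
  rw [h2, pi_gaussianReal_eq_withDensity,
    lintegral_withDensity_eq_lintegral_mul _
      (measurable_shiftDensity h).ennreal_ofReal hg]
  rfl

lemma lintegral_shiftDensity {ι : Type*} [Fintype ι] (h : ι → ℝ) :
    ∫⁻ x, ENNReal.ofReal (shiftDensity h x) ∂(stdGaussianPi ι) = 1 := by
  have := lintegral_shift h (g := fun _ => 1) measurable_const
  simpa using this.symm

lemma shiftDensity_mul {ι : Type*} [Fintype ι] (h k x : ι → ℝ) :
    shiftDensity h x * shiftDensity k x =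
      Real.exp (∑ i, h i * k i) * shiftDensity (h + k) x := by
  simp only [shiftDensity, ← Real.exp_add, ← Finset.sum_add_distrib]
  congr 1
  refine Finset.sum_congr rfl fun i _ => ?_
  simp only [Pi.add_apply]
  ring

/-- Completing the square turns the product into a multiple of another shift density. These cross
moments are the terms of the second moment of a mixture. -/
lemma lintegral_shiftDensity_mul {ι : Type*} [Fintype ι] (h k : ι → ℝ) :
    ∫⁻ x, ENNReal.ofReal (shiftDensity h x * shiftDensity k x) ∂(stdGaussianPi ι) =
      ENNReal.ofReal (Real.exp (∑ i, h i * k i)) := by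
  simp_rw [shiftDensity_mul, ENNReal.ofReal_mul (Real.exp_pos _).le]
  rw [lintegral_const_mul _ (measurable_shiftDensity _).ennreal_ofReal, lintegral_shiftDensity,
    mul_one]

lemma lintegral_obsLaw {d : ℕ} (σ : ℝ) (θ : Fin d → ℝ) {g : (Fin d → ℝ) → ℝ≥0∞}
    (hg : Measurable g) :
    ∫⁻ y, g y ∂(obsLaw σ θ) = ∫⁻ x, g (fun j => θ j + σ * x j) ∂(stdGaussianPi (Fin d)) := by
  rw [obsLaw, lintegral_map hg (by fun_prop)]

/-! ### Minimax lower bound by testing against a mixture -/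

/-- Lower bound on the worse of two quadratic risks when the alternative has density `ℓ` with
second moment at most `9` relative to the null law `μ`. -/
lemma two_hypotheses_lower_bound {Ω : Type*} [MeasurableSpace Ω] {μ : Measure Ω} {ℓ T : Ω → ℝ}
    (hℓm : Measurable ℓ) (hTm : Measurable T) (hℓ0 : ∀ x, 0 ≤ ℓ x) {v : ℝ} {M : ℝ≥0∞}
    (hℓ1 : ∫⁻ x, ENNReal.ofReal (ℓ x) ∂μ = 1) (hℓ2 : ∫⁻ x, ENNReal.ofReal (ℓ x ^ 2) ∂μ ≤ 9)
    (hnull : ∫⁻ x, ENNReal.ofReal (T x ^ 2) ∂μ ≤ M)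
    (halt : ∫⁻ x, ENNReal.ofReal (ℓ x * (T x - v) ^ 2) ∂μ ≤ M) :
    ENNReal.ofReal (v ^ 2 / 20) ≤ M := by
  -- This combines `v T + (T - v)² = (T - v/2)² + 3v²/4` with `ℓ v T ≤ (ℓ v / 6)² + (3 T)²`. After
  -- integration the `ℓ²` term costs at most `v² / 4`, which leaves `v² / 2 ≤ 10 M`.
  have hpt : ∀ x, ENNReal.ofReal (3 / 4 * v ^ 2) * ENNReal.ofReal (ℓ x) ≤
      ENNReal.ofReal (v ^ 2 / 36) * ENNReal.ofReal (ℓ x ^ 2) +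
        (9 * ENNReal.ofReal (T x ^ 2) + ENNReal.ofReal (ℓ x * (T x - v) ^ 2)) := by
    intro x
    have hx := hℓ0 x
    have h9 : (9 : ℝ≥0∞) = ENNReal.ofReal 9 := by norm_num
    rw [h9, ← ENNReal.ofReal_mul (by positivity), ← ENNReal.ofReal_mul (by positivity),
      ← ENNReal.ofReal_mul (by positivity), ← ENNReal.ofReal_add (by positivity) (by positivity),
      ← ENNReal.ofReal_add (by positivity) (by positivity)]
    refine ENNReal.ofReal_le_ofReal ?_
    nlinarith [sq_nonneg (ℓ x * v / 6 - 3 * T x), mul_nonneg hx (sq_nonneg (v / 2 - (v - T x)))]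
  have hint := lintegral_mono (μ := μ) hpt
  rw [lintegral_const_mul _ (by fun_prop), lintegral_add_left (by fun_prop),
    lintegral_const_mul _ (by fun_prop), lintegral_add_left (by fun_prop),
    lintegral_const_mul _ (by fun_prop), hℓ1, mul_one] at hint
  rcases eq_or_ne M ∞ with rfl | hM
  · exact le_top
  have hle : ENNReal.ofReal (3 / 4 * v ^ 2) ≤
      ENNReal.ofReal (v ^ 2 / 36) * 9 + (9 * M + M) :=
    hint.trans (by gcongr)
  lift M to NNReal using hM
  have h9 : (9 : ℝ≥0∞) = ENNReal.ofReal 9 := by norm_num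
  have hMr : (M : ℝ≥0∞) = ENNReal.ofReal (M : ℝ) := by simp
  have hM0 : (0 : ℝ) ≤ M := M.2
  rw [h9, hMr, ← ENNReal.ofReal_mul (by positivity), ← ENNReal.ofReal_mul (by positivity),
    ← ENNReal.ofReal_add (by positivity) (by positivity),
    ← ENNReal.ofReal_add (by positivity) (by positivity),
    ENNReal.ofReal_le_ofReal_iff (by positivity)] at hle
  rw [hMr]
  exact ENNReal.ofReal_le_ofReal (by linarith)

/-- Lower bound on the minimax risk by a finite mixture of alternatives `σ • h f` with the same
value `v` of the functional, tested against the zero vector. -/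
lemma le_minimaxSqRisk_of_mixture {d : ℕ} {F : Type*} [Fintype F] [Nonempty F] {σ : ℝ}
    (h : F → Fin d → ℝ) {v : ℝ} {Θ : Set (Fin d → ℝ)} (h0 : 0 ∈ Θ)
    (hΘ : ∀ f, σ • h f ∈ Θ) (hv : ∀ f, linFun (σ • h f) = v)
    (hchi : ∑ f, ∑ g, Real.exp (∑ i, h f i * h g i) ≤ 9 * (Fintype.card F : ℝ) ^ 2) :
    ENNReal.ofReal (v ^ 2 / 20) ≤ minimaxSqRisk σ linFun Θ := by
  refine le_iInf₂ fun That hT => ?_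
  set N : ℝ := (Fintype.card F : ℝ) with hN
  have hNpos : 0 < N := by simpa [hN] using Fintype.card_pos (α := F)
  have hTm : Measurable fun x : Fin d → ℝ => That (fun j => σ * x j) :=
    hT.comp (by fun_prop)
  have hDm := fun f => measurable_shiftDensity (h f)
  have hD0 := fun f x => (shiftDensity_pos (h f) x).le
  -- The risk at `σ • h f`, rewritten under the null law by the change of measure.
  have hrisk : ∀ f, ∫⁻ x, ENNReal.ofReal (shiftDensity (h f) x *
      (That (fun j => σ * x j) - v) ^ 2) ∂(stdGaussianPi (Fin d)) ≤
      maxRisk σ linFun Θ That := by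
    intro f
    refine le_trans (le_of_eq ?_) (le_iSup₂ (σ • h f) (hΘ f))
    rw [lintegral_obsLaw _ _ (by fun_prop), hv f]
    have := lintegral_shift (h f)
      (g := fun x => ENNReal.ofReal ((That (fun j => σ * x j) - v) ^ 2)) (by fun_prop)
    simp_rw [ENNReal.ofReal_mul (hD0 f _), ← this, Pi.smul_apply, smul_eq_mul, mul_add]
  refine two_hypotheses_lower_bound (μ := stdGaussianPi (Fin d))
    (ℓ := fun x => ∑ f, N⁻¹ * shiftDensity (h f) x)
    (T := fun x => That (fun j => σ * x j)) (by fun_prop) hTm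
    (fun x => Finset.sum_nonneg fun f _ => mul_nonneg (by positivity) (hD0 f x)) ?_ ?_ ?_ ?_
  · have : ∀ x, ENNReal.ofReal (∑ f, N⁻¹ * shiftDensity (h f) x) =
        ∑ f, ENNReal.ofReal N⁻¹ * ENNReal.ofReal (shiftDensity (h f) x) := fun x => by
      rw [ENNReal.ofReal_sum_of_nonneg fun f _ => mul_nonneg (by positivity) (hD0 f x)]
      exact Finset.sum_congr rfl fun f _ => ENNReal.ofReal_mul (by positivity)
    simp_rw [this]
    rw [lintegral_finsetSum _ fun f _ => by fun_prop]
    simp_rw [lintegral_const_mul _ (hDm _).ennreal_ofReal, lintegral_shiftDensity]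
    rw [Finset.sum_const, mul_one, nsmul_eq_mul, Finset.card_univ,
      ← ENNReal.ofReal_natCast, ← ENNReal.ofReal_mul (by positivity), ← hN,
      mul_inv_cancel₀ hNpos.ne', ENNReal.ofReal_one]
  · have : ∀ x, ENNReal.ofReal ((∑ f, N⁻¹ * shiftDensity (h f) x) ^ 2) =
        ∑ f, ∑ g, ENNReal.ofReal (N⁻¹ ^ 2) *
          ENNReal.ofReal (shiftDensity (h f) x * shiftDensity (h g) x) := fun x => by
      have hnn : ∀ f g, 0 ≤ N⁻¹ ^ 2 * (shiftDensity (h f) x * shiftDensity (h g) x) :=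
        fun f g => mul_nonneg (by positivity) (mul_nonneg (hD0 f x) (hD0 g x))
      rw [sq, Finset.sum_mul_sum]
      have he : ∀ f g, N⁻¹ * shiftDensity (h f) x * (N⁻¹ * shiftDensity (h g) x) =
          N⁻¹ ^ 2 * (shiftDensity (h f) x * shiftDensity (h g) x) := fun f g => by ring
      simp_rw [he, ← ENNReal.ofReal_mul (show (0 : ℝ) ≤ N⁻¹ ^ 2 by positivity)]
      rw [ENNReal.ofReal_sum_of_nonneg fun f _ => Finset.sum_nonneg fun g _ => hnn f g]
      exact Finset.sum_congr rfl fun f _ => ENNReal.ofReal_sum_of_nonneg fun g _ => hnn f g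
    simp_rw [this]
    rw [lintegral_finsetSum _ fun f _ => by fun_prop]
    rw [Finset.sum_congr rfl fun f _ => lintegral_finsetSum _ fun g _ => by fun_prop]
    rw [Finset.sum_congr rfl fun f _ => Finset.sum_congr rfl fun g _ =>
      lintegral_const_mul _ (by fun_prop)]
    simp_rw [lintegral_shiftDensity_mul, ← Finset.mul_sum]
    have hs : ∑ f, ∑ g, ENNReal.ofReal (Real.exp (∑ i, h f i * h g i)) =
        ENNReal.ofReal (∑ f, ∑ g, Real.exp (∑ i, h f i * h g i)) := by
      rw [ENNReal.ofReal_sum_of_nonneg fun f _ =>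
        Finset.sum_nonneg fun g _ => (Real.exp_pos _).le]
      exact Finset.sum_congr rfl fun f _ =>
        (ENNReal.ofReal_sum_of_nonneg fun g _ => (Real.exp_pos _).le).symm
    rw [hs, ← ENNReal.ofReal_mul (by positivity),
      show (9 : ℝ≥0∞) = ENNReal.ofReal 9 by norm_num]
    refine ENNReal.ofReal_le_ofReal ?_
    calc N⁻¹ ^ 2 * ∑ f, ∑ g, Real.exp (∑ i, h f i * h g i)
        ≤ N⁻¹ ^ 2 * (9 * N ^ 2) := by gcongr
      _ = 9 := by field_simp
  · refine le_trans (le_of_eq ?_) (le_iSup₂ (0 : Fin d → ℝ) h0)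
    rw [lintegral_obsLaw _ _ (by fun_prop)]
    simp [linFun]
  · have : ∀ x, ENNReal.ofReal ((∑ f, N⁻¹ * shiftDensity (h f) x) *
          (That (fun j => σ * x j) - v) ^ 2) =
        ∑ f, ENNReal.ofReal N⁻¹ * ENNReal.ofReal (shiftDensity (h f) x *
          (That (fun j => σ * x j) - v) ^ 2) := fun x => by
      have hnn : ∀ f, 0 ≤ N⁻¹ * (shiftDensity (h f) x * (That (fun j => σ * x j) - v) ^ 2) :=
        fun f => mul_nonneg (by positivity) (mul_nonneg (hD0 f x) (sq_nonneg _))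
      simp_rw [Finset.sum_mul, mul_assoc]
      rw [ENNReal.ofReal_sum_of_nonneg fun f _ => hnn f]
      exact Finset.sum_congr rfl fun f _ => ENNReal.ofReal_mul (by positivity)
    simp_rw [this]
    rw [lintegral_finsetSum _ fun f _ => by fun_prop]
    calc _ ≤ ∑ _f : F, ENNReal.ofReal N⁻¹ * maxRisk σ linFun Θ That := by
          refine Finset.sum_le_sum fun f _ => ?_
          rw [lintegral_const_mul _ (by fun_prop)]
          gcongr
          exact hrisk f
      _ = maxRisk σ linFun Θ That := by
          rw [Finset.sum_const, nsmul_eq_mul, Finset.card_univ, ← mul_assoc,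
            ← ENNReal.ofReal_natCast, ← ENNReal.ofReal_mul (by positivity), ← hN,
            mul_inv_cancel₀ hNpos.ne', ENNReal.ofReal_one, one_mul]

/-! ### The block prior and its second moment -/

/-- The vector with entry `b` at one chosen position `e (i, f i)` of each block `i`. -/
noncomputable def blockVector {ι κ ν : Type*} [Fintype ι] [DecidableEq ν] (e : ι × κ → ν) (b : ℝ)
    (f : ι → κ) (k : ν) : ℝ :=
  ∑ i, if e (i, f i) = k then b else 0

lemma sum_blockVector {ι κ ν : Type*} [Fintype ι] [Fintype ν] [DecidableEq ν]
    (e : ι × κ → ν) (b : ℝ) (f : ι → κ) : ∑ k, blockVector e b f k = Fintype.card ι * b := by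
  unfold blockVector
  rw [Finset.sum_comm]
  simp

/-- Blocks are disjoint by injectivity of `e`, so two vectors overlap only where their choices
agree. -/
lemma sum_blockVector_mul {ι κ ν : Type*} [Fintype ι] [Fintype ν] [DecidableEq ν] [DecidableEq ι]
    [DecidableEq κ] {e : ι × κ → ν} (he : Function.Injective e) (b : ℝ) (f g : ι → κ) :
    ∑ k, blockVector e b f k * blockVector e b g k = ∑ i, if f i = g i then b ^ 2 else 0 := by
  have h1 : ∀ k, blockVector e b f k * blockVector e b g k =
      ∑ i, ∑ j, if e (i, f i) = k then (if e (j, g j) = k then b ^ 2 else 0) else 0 := by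
    intro k
    unfold blockVector
    rw [Finset.sum_mul_sum]
    refine Finset.sum_congr rfl fun i _ => Finset.sum_congr rfl fun j _ => ?_
    split_ifs <;> ring
  simp_rw [h1]
  rw [Finset.sum_comm]
  refine Finset.sum_congr rfl fun i _ => ?_
  rw [Finset.sum_comm]
  have h2 : ∀ j, (∑ k, if e (i, f i) = k then (if e (j, g j) = k then b ^ 2 else 0) else 0) =
      if i = j then (if f i = g i then b ^ 2 else 0) else 0 := by
    intro j
    rw [Finset.sum_ite_eq Finset.univ (e (i, f i)), if_pos (Finset.mem_univ _)]
    by_cases hij : i = j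
    · subst hij
      by_cases hfg : f i = g i
      · simp [hfg]
      · rw [if_neg fun hh => hfg (Prod.ext_iff.1 (he hh)).2.symm, if_neg hfg, if_pos rfl]
    · rw [if_neg fun hh => hij (Prod.ext_iff.1 (he hh)).1.symm, if_neg hij]
  simp_rw [h2]
  simp

/-- For fixed `f` the sum over `g` factorises over blocks; each block has one agreeing choice,
contributing `exp (b²)`, and every other choice contributes `1`, whatever `f` is. -/
lemma sum_exp_blockVector {ι κ ν : Type*} [Fintype ι] [Fintype ν] [DecidableEq ν] [DecidableEq ι]
    [Fintype κ] [Nonempty κ] {e : ι × κ → ν} (he : Function.Injective e) (b : ℝ) :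
    ∑ f : ι → κ, ∑ g : ι → κ, Real.exp (∑ k, blockVector e b f k * blockVector e b g k) =
      (Fintype.card (ι → κ) : ℝ) ^ 2 *
        (1 + (Real.exp (b ^ 2) - 1) / Fintype.card κ) ^ Fintype.card ι := by
  classical
  have hκ : (Fintype.card κ : ℝ) ≠ 0 := by simp
  have h1 : ∀ f : ι → κ, ∑ g : ι → κ,
      Real.exp (∑ k, blockVector e b f k * blockVector e b g k) =
      (Fintype.card κ + (Real.exp (b ^ 2) - 1)) ^ Fintype.card ι := by
    intro f
    simp_rw [sum_blockVector_mul he b, Real.exp_sum]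
    rw [← Fintype.prod_sum fun i j => Real.exp (if f i = j then b ^ 2 else 0)]
    have h2 : ∀ i, ∑ j, Real.exp (if f i = j then b ^ 2 else 0) =
        Fintype.card κ + (Real.exp (b ^ 2) - 1) := by
      intro i
      have h3 : ∀ j, Real.exp (if f i = j then b ^ 2 else 0) =
          1 + if f i = j then Real.exp (b ^ 2) - 1 else 0 := by
        intro j
        split_ifs <;> simp
      simp_rw [h3]
      simp [Finset.sum_add_distrib]
    simp_rw [h2]
    rw [Finset.prod_const, Finset.card_univ]
  simp_rw [h1]
  rw [Finset.sum_const, nsmul_eq_mul, Finset.card_univ, sq (Fintype.card (ι → κ) : ℝ), mul_assoc]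
  congr 1
  rw [Fintype.card_fun, Nat.cast_pow, ← mul_pow]
  congr 1
  field_simp

lemma hammingNorm_smul_blockVector_le {ι κ ν : Type*} [Fintype ι] [Fintype ν] [DecidableEq ν]
    (e : ι × κ → ν) (b σ : ℝ) (f : ι → κ) :
    hammingNorm (σ • blockVector e b f) ≤ Fintype.card ι := by
  refine le_trans (Finset.card_le_card (t := Finset.univ.image fun i => e (i, f i)) ?_)
    Finset.card_image_le
  intro k hk
  by_contra hk'
  simp only [Finset.mem_image, Finset.mem_univ, true_and, not_exists] at hk'
  simp [blockVector, hk'] at hk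

/-- Rounding loses at most a factor two, `d / s ≤ 2 ⌊d / s⌋`, so the power is at most `(1 + 2 / s) ^
s ≤ e² < 9`. -/
lemma one_add_div_pow_le_nine {s d : ℕ} (hs : 1 ≤ s) (hsd : s ≤ d) :
    (1 + (d : ℝ) / (s : ℝ) ^ 2 / ((d / s : ℕ) : ℝ)) ^ s ≤ 9 := by
  have hs0 : (0 : ℝ) < s := by exact_mod_cast hs
  have hm : 1 ≤ d / s := (Nat.one_le_div_iff hs).2 hsd
  have hm0 : (0 : ℝ) < ((d / s : ℕ) : ℝ) := by exact_mod_cast hm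
  have hd : (d : ℝ) ≤ 2 * s * ((d / s : ℕ) : ℝ) := by
    have h1 : d < s * (d / s + 1) := Nat.lt_mul_div_succ d hs
    have h2 : d ≤ 2 * s * (d / s) := by nlinarith
    exact_mod_cast h2
  have h1 : (d : ℝ) / (s : ℝ) ^ 2 / ((d / s : ℕ) : ℝ) ≤ 2 / s := by
    rw [div_div, div_le_div_iff₀ (by positivity) hs0]
    nlinarith
  calc (1 + (d : ℝ) / (s : ℝ) ^ 2 / ((d / s : ℕ) : ℝ)) ^ s
      ≤ (Real.exp (2 / s)) ^ s := by
        gcongr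
        linarith [Real.add_one_le_exp (2 / (s : ℝ))]
    _ = Real.exp 1 ^ 2 := by
        rw [← Real.exp_nat_mul, ← Real.exp_nat_mul]
        congr 1
        field_simp
        norm_num
    _ ≤ 9 := by nlinarith [Real.exp_one_lt_d9, Real.exp_pos 1]

lemma linRate_div_le_minimaxSqRisk {s d : ℕ} (σ : ℝ) (hs : 1 ≤ s) (hsd : s ≤ d) :
    ENNReal.ofReal (linRate σ s d / 20) ≤ minimaxSqRisk σ linFun (sparseClass d s) := by
  have hs0 : (0 : ℝ) < s := by exact_mod_cast hs
  have hm : 1 ≤ d / s := (Nat.one_le_div_iff hs).2 hsd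
  have hlog : 0 ≤ Real.log (1 + (d : ℝ) / (s : ℝ) ^ 2) :=
    Real.log_nonneg (by linarith [show 0 ≤ (d : ℝ) / (s : ℝ) ^ 2 by positivity])
  -- This makes `exp (b²) - 1 = d / s²` and `(σ s b)² = linRate σ s d`.
  set b : ℝ := √(Real.log (1 + (d : ℝ) / (s : ℝ) ^ 2)) with hb
  have hb2 : b ^ 2 = Real.log (1 + (d : ℝ) / (s : ℝ) ^ 2) := Real.sq_sqrt hlog
  -- The blocks have `⌊d / s⌋` coordinates each; the remaining coordinates stay zero.
  let e : Fin s × Fin (d / s) → Fin d := fun p =>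
    Fin.castLE (Nat.mul_div_le d s) (finProdFinEquiv p)
  have he : Function.Injective e :=
    (Fin.castLE_injective _).comp finProdFinEquiv.injective
  have : Nonempty (Fin (d / s)) := ⟨⟨0, hm⟩⟩
  have key := le_minimaxSqRisk_of_mixture (σ := σ)
    (fun f : Fin s → Fin (d / s) => blockVector e b f) (v := σ * (s * b))
    (Θ := sparseClass d s) (by simp [sparseClass])
    (fun f => by simpa [sparseClass] using hammingNorm_smul_blockVector_le e b σ f)
    (fun f => by
      have := sum_blockVector e b f
      rw [Fintype.card_fin] at this
      simp only [linFun, Pi.smul_apply, smul_eq_mul, ← Finset.mul_sum, this])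
    (by
      rw [sum_exp_blockVector he b, mul_comm]
      gcongr
      rw [hb2, Real.exp_log (by positivity), Fintype.card_fin, Fintype.card_fin,
        add_sub_cancel_left]
      exact one_add_div_pow_le_nine hs hsd)
  convert key using 2
  rw [linRate, ← hb2]
  ring

/-! ### Gaussian moments, tails and sums of independent terms -/

lemma lintegral_sq_gaussianReal : ∫⁻ x, ENNReal.ofReal (x ^ 2) ∂(gaussianReal 0 1) = 1 := by
  have h1 : MemLp (fun x : ℝ => x) 2 (gaussianReal 0 1) := memLp_id_gaussianReal 2
  have h2 := ofReal_variance h1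
  rw [evariance_eq_lintegral_ofReal, variance_fun_id_gaussianReal, integral_id_gaussianReal] at h2
  simpa using h2.symm

lemma lintegral_const_add_sq_gaussianReal (x : ℝ) :
    ∫⁻ u, ENNReal.ofReal (2 * (x ^ 2 + u ^ 2)) ∂(gaussianReal 0 1) =
      ENNReal.ofReal (2 * (x ^ 2 + 1)) := by
  have : ∀ u : ℝ, ENNReal.ofReal (2 * (x ^ 2 + u ^ 2)) =
      ENNReal.ofReal (2 * x ^ 2) + 2 * ENNReal.ofReal (u ^ 2) := fun u => by
    rw [show (2 : ℝ≥0∞) = ENNReal.ofReal 2 by norm_num, ← ENNReal.ofReal_mul (by positivity),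
      ← ENNReal.ofReal_add (by positivity) (by positivity)]
    ring_nf
  simp_rw [this]
  rw [lintegral_add_left measurable_const, lintegral_const_mul _ (by fun_prop),
    lintegral_sq_gaussianReal, lintegral_const, measure_univ, mul_one, mul_one,
    show (2 : ℝ≥0∞) = ENNReal.ofReal 2 by norm_num,
    ← ENNReal.ofReal_add (by positivity) (by positivity)]
  ring_nf

/-- After translating by `x`, the density factor `exp (-x u - x² / 2)` is at most `exp (-x² / 2)`
for `u > 0`, and `(x + u)² ≤ 2 (x² + u²)`. -/
lemma lintegral_sq_Ioi_gaussianReal_le {x : ℝ} (hx : 0 ≤ x) :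
    ∫⁻ u, ENNReal.ofReal (if x < u then u ^ 2 else 0) ∂(gaussianReal 0 1) ≤
      ENNReal.ofReal (2 * (x ^ 2 + 1) * Real.exp (-x ^ 2 / 2)) := by
  have hm : Measurable fun u : ℝ => if x < u then u ^ 2 else 0 :=
    Measurable.ite measurableSet_Ioi (by fun_prop) measurable_const
  have hmap : gaussianReal 0 1 = (gaussianReal (-x) 1).map (x + ·) := by
    rw [gaussianReal_map_const_add, neg_add_cancel]
  have hshift : Measurable fun u : ℝ =>
      ENNReal.ofReal (if x < x + u then (x + u) ^ 2 else 0) :=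
    hm.ennreal_ofReal.comp (by fun_prop : Measurable fun u : ℝ => x + u)
  conv_lhs => rw [hmap]
  rw [lintegral_map hm.ennreal_ofReal (by fun_prop), gaussianReal_eq_withDensity_std,
    lintegral_withDensity_eq_lintegral_mul _ (by fun_prop)
      hshift]
  calc _ ≤ ∫⁻ u, ENNReal.ofReal (Real.exp (-x ^ 2 / 2)) *
        ENNReal.ofReal (2 * (x ^ 2 + u ^ 2)) ∂(gaussianReal 0 1) := by
        refine lintegral_mono fun u => ?_
        simp only [Pi.mul_apply]
        rw [← ENNReal.ofReal_mul (Real.exp_pos _).le, ← ENNReal.ofReal_mul (Real.exp_pos _).le]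
        refine ENNReal.ofReal_le_ofReal ?_
        split_ifs with h
        · have hu : 0 < u := by linarith
          refine mul_le_mul (Real.exp_le_exp.2 ?_) ?_ (by positivity) (Real.exp_pos _).le
          · nlinarith [mul_nonneg hx hu.le]
          · nlinarith [sq_nonneg (x - u)]
        · rw [mul_zero]
          positivity
    _ = _ := by
        rw [lintegral_const_mul _ (by fun_prop), lintegral_const_add_sq_gaussianReal,
          ← ENNReal.ofReal_mul (Real.exp_pos _).le, mul_comm]

lemma lintegral_sq_tail_gaussianReal_le {x : ℝ} (hx : 0 ≤ x) :
    ∫⁻ u, ENNReal.ofReal (if x < |u| then u ^ 2 else 0) ∂(gaussianReal 0 1) ≤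
      ENNReal.ofReal (4 * (x ^ 2 + 1) * Real.exp (-x ^ 2 / 2)) := by
  have hm : Measurable fun u : ℝ => if x < u then u ^ 2 else 0 :=
    Measurable.ite measurableSet_Ioi (by fun_prop) measurable_const
  have hneg : ∫⁻ u, ENNReal.ofReal (if x < -u then (-u) ^ 2 else 0) ∂(gaussianReal 0 1) =
      ∫⁻ u, ENNReal.ofReal (if x < u then u ^ 2 else 0) ∂(gaussianReal 0 1) := by
    have hmap : gaussianReal 0 1 = (gaussianReal 0 1).map fun u => -u := by
      rw [gaussianReal_map_neg, neg_zero]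
    conv_rhs => rw [hmap]
    rw [lintegral_map hm.ennreal_ofReal measurable_neg]
  calc _ ≤ ∫⁻ u, (ENNReal.ofReal (if x < u then u ^ 2 else 0) +
        ENNReal.ofReal (if x < -u then (-u) ^ 2 else 0)) ∂(gaussianReal 0 1) := by
        refine lintegral_mono fun u => ?_
        rw [← ENNReal.ofReal_add (by split_ifs <;> positivity) (by split_ifs <;> positivity)]
        refine ENNReal.ofReal_le_ofReal ?_
        by_cases h1 : x < u
        · rw [if_pos h1]
          split_ifs <;> nlinarith [sq_nonneg u]
        · by_cases h2 : x < -u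
          · rw [if_pos h2]
            split_ifs <;> nlinarith [sq_nonneg u]
          · rw [if_neg h1, if_neg h2, if_neg fun h => (lt_abs.1 h).elim h1 h2, add_zero]
    _ ≤ _ := by
        rw [lintegral_add_left hm.ennreal_ofReal, hneg]
        refine (add_le_add (lintegral_sq_Ioi_gaussianReal_le hx)
          (lintegral_sq_Ioi_gaussianReal_le hx)).trans (le_of_eq ?_)
        rw [← ENNReal.ofReal_add (by positivity) (by positivity)]
        ring_nf

/-- A sum of centered square-integrable functions of distinct coordinates has second moment equal
to the sum of the second moments. -/
lemma lintegral_sum_sq_pi {ι : Type*} [Fintype ι] {Ω : ι → Type*} [∀ i, MeasurableSpace (Ω i)]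
    {μ : ∀ i, Measure (Ω i)} [∀ i, IsProbabilityMeasure (μ i)] {X : ∀ i, Ω i → ℝ}
    (hX : ∀ i, MemLp (X i) 2 (μ i)) (hX0 : ∀ i, ∫ x, X i x ∂(μ i) = 0) :
    ∫⁻ x, ENNReal.ofReal ((∑ i, X i (x i)) ^ 2) ∂(Measure.pi μ) =
      ∑ i, ∫⁻ x, ENNReal.ofReal (X i x ^ 2) ∂(μ i) := by
  have hmem : ∀ i, MemLp (fun x : ∀ i, Ω i => X i (x i)) 2 (Measure.pi μ) := fun i =>
    (hX i).comp_measurePreserving (measurePreserving_eval μ i)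
  have hcoord : ∀ i, ∫ x, X i (x i) ∂(Measure.pi μ) = 0 := fun i => by
    rw [integral_comp_eval (hX i).aestronglyMeasurable, hX0 i]
  have hmean : ∫ x, ∑ i, X i (x i) ∂(Measure.pi μ) = 0 := by
    rw [integral_finsetSum _ fun i _ => (hmem i).integrable one_le_two]
    simp [hcoord]
  have hsum : MemLp (∑ i, fun x : ∀ i, Ω i => X i (x i)) 2 (Measure.pi μ) :=
    memLp_finsetSum' _ fun i _ => hmem i
  have h1 := ofReal_variance hsum
  rw [variance_sum_pi hX, evariance_eq_lintegral_ofReal,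
    ENNReal.ofReal_sum_of_nonneg fun i _ => variance_nonneg _ _] at h1
  simp only [Finset.sum_apply, hmean, sub_zero] at h1
  rw [← h1]
  refine Finset.sum_congr rfl fun i _ => ?_
  rw [ofReal_variance (hX i), evariance_eq_lintegral_ofReal, hX0 i]
  simp

/-! ### The estimator, the rate and the dense regime -/

lemma measurable_linEstimator {d : ℕ} (σ : ℝ) (s : ℕ) :
    Measurable (linEstimator (d := d) σ s) := by
  unfold linEstimator
  split_ifs
  · refine Finset.measurable_fun_sum _ fun j _ => Measurable.ite ?_ (by fun_prop) measurable_const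
    exact measurableSet_lt measurable_const (by fun_prop)
  · fun_prop

/-- From `log (1 + t) ≤ t`; it makes the minimum in the theorem equal to `linRate`. -/
lemma linRate_le {s d : ℕ} (σ : ℝ) (hs : 1 ≤ s) : linRate σ s d ≤ σ ^ 2 * d := by
  have hs0 : (0 : ℝ) < s := by exact_mod_cast hs
  have h1 : Real.log (1 + (d : ℝ) / (s : ℝ) ^ 2) ≤ (d : ℝ) / (s : ℝ) ^ 2 := by
    have := Real.log_le_sub_one_of_pos (show 0 < 1 + (d : ℝ) / (s : ℝ) ^ 2 by positivity)
    linarith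
  calc linRate σ s d ≤ σ ^ 2 * (s : ℝ) ^ 2 * ((d : ℝ) / (s : ℝ) ^ 2) := by
        unfold linRate
        gcongr
    _ = σ ^ 2 * d := by field_simp

lemma linRate_nonneg (σ : ℝ) (s d : ℕ) : 0 ≤ linRate σ s d := by
  unfold linRate
  have : 0 ≤ Real.log (1 + (d : ℝ) / (s : ℝ) ^ 2) :=
    Real.log_nonneg (by linarith [show 0 ≤ (d : ℝ) / (s : ℝ) ^ 2 by positivity])
  positivity

/-- The error of the sum is pure noise, so its risk is `σ² d` at every `θ`. With `t = d / s² ≤ 1`,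
`log (1 + t) ≥ t / (1 + t) ≥ t / 2`. -/
lemma maxRisk_linEstimator_dense {s d : ℕ} {σ : ℝ} (hs : 1 ≤ s)
    (hsd : ¬ (s : ℝ) < √(d : ℝ)) (Θ : Set (Fin d → ℝ)) :
    maxRisk σ linFun Θ (linEstimator σ s) ≤ ENNReal.ofReal (2 * linRate σ s d) := by
  have hs0 : (0 : ℝ) < s := by exact_mod_cast hs
  refine iSup₂_le fun θ _ => ?_
  have hE : ∀ y : Fin d → ℝ, linEstimator σ s y = ∑ j, y j := fun y => if_neg hsd
  simp_rw [hE]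
  rw [lintegral_obsLaw _ _ (by fun_prop)]
  simp_rw [linFun, Finset.sum_add_distrib, add_sub_cancel_left]
  rw [lintegral_sum_sq_pi (μ := fun _ => gaussianReal 0 1) (X := fun _ u => σ * u)
    (fun _ => (memLp_id_gaussianReal 2).const_mul σ) fun _ => by
      rw [integral_const_mul, integral_id_gaussianReal, mul_zero]]
  simp_rw [mul_pow, ENNReal.ofReal_mul (sq_nonneg σ)]
  rw [lintegral_const_mul _ (by fun_prop), lintegral_sq_gaussianReal, mul_one, Finset.sum_const,
    nsmul_eq_mul, Finset.card_univ, Fintype.card_fin, ← ENNReal.ofReal_natCast,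
    ← ENNReal.ofReal_mul (by positivity)]
  refine ENNReal.ofReal_le_ofReal ?_
  have hd : (d : ℝ) ≤ (s : ℝ) ^ 2 := (Real.sqrt_le_left hs0.le).1 (not_lt.1 hsd)
  have hlog := Real.one_sub_inv_le_log_of_pos
    (show 0 < 1 + (d : ℝ) / (s : ℝ) ^ 2 by positivity)
  have hlow : (d : ℝ) ≤ 2 * ((s : ℝ) ^ 2 * Real.log (1 + (d : ℝ) / (s : ℝ) ^ 2)) := by
    calc (d : ℝ) ≤ 2 * ((s : ℝ) ^ 2 * (1 - (1 + (d : ℝ) / (s : ℝ) ^ 2)⁻¹)) := by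
          have : 2 * ((s : ℝ) ^ 2 * (1 - (1 + (d : ℝ) / (s : ℝ) ^ 2)⁻¹)) =
              2 * (s : ℝ) ^ 2 * d / ((s : ℝ) ^ 2 + d) := by
            field_simp
            ring
          rw [this, le_div_iff₀ (by positivity)]
          nlinarith [Nat.cast_nonneg (α := ℝ) d]
      _ ≤ _ := by gcongr
  unfold linRate
  nlinarith [mul_le_mul_of_nonneg_left hlow (sq_nonneg σ)]

/-! ### Hard thresholding in the sparse regime -/

/-- Error of hard thresholding at the level `τ` on the coordinate with mean `a`. -/
lemma sq_hardThreshold_sub_le (τ a σ u : ℝ) :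
    ((if τ < |a + σ * u| then a + σ * u else 0) - a) ^ 2 ≤ 2 * (τ ^ 2 + σ ^ 2 * u ^ 2) := by
  split_ifs with h
  · nlinarith [sq_nonneg (σ * u), sq_nonneg τ]
  · have h1 : (a + σ * u) ^ 2 ≤ τ ^ 2 := by
      rw [← sq_abs]
      gcongr
      exact not_lt.1 h
    nlinarith [sq_nonneg (a + 2 * (σ * u))]

/-- By symmetry. Centring removes the cross terms off the support, so that part costs a factor `d`
and not `d²`. -/
lemma integral_hardThreshold_gaussianReal (τ : ℝ) :
    ∫ u, (if τ < |u| then u else 0) ∂(gaussianReal 0 1) = 0 := by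
  have hm : Measurable fun u : ℝ => if τ < |u| then u else 0 :=
    Measurable.ite (measurableSet_lt measurable_const (by fun_prop)) measurable_id measurable_const
  have hmap : gaussianReal 0 1 = (gaussianReal 0 1).map fun u => -u := by
    rw [gaussianReal_map_neg, neg_zero]
  have h := integral_map (μ := gaussianReal 0 1) (φ := fun u : ℝ => -u) (by fun_prop)
    hm.aestronglyMeasurable
  rw [← hmap] at h
  have h2 : ∀ u : ℝ, (if τ < |-u| then -u else 0) = -(if τ < |u| then u else 0) := fun u => by
    rw [abs_neg]
    split_ifs <;> simp
  simp_rw [h2] at h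
  rw [integral_neg] at h
  linarith

lemma memLp_hardThreshold_gaussianReal (τ : ℝ) :
    MemLp (fun u : ℝ => if τ < |u| then u else 0) 2 (gaussianReal 0 1) := by
  refine MemLp.mono (memLp_id_gaussianReal 2) (Measurable.ite
    (measurableSet_lt measurable_const (by fun_prop)) measurable_id
    measurable_const).aestronglyMeasurable (ae_of_all _ fun u => ?_)
  split_ifs <;> simp

/-- Risk bound of the hard thresholding estimator of the sum at the level `σ x`. -/
lemma lintegral_hardThreshold_sum_le {s d : ℕ} {σ x : ℝ} (hσ : 0 < σ) (hx : 0 ≤ x)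
    {θ : Fin d → ℝ} (hθ : θ ∈ sparseClass d s) :
    ∫⁻ y, ENNReal.ofReal (((∑ j, if σ * x < |y j| then y j else 0) - linFun θ) ^ 2)
        ∂(obsLaw σ θ) ≤
      ENNReal.ofReal (σ ^ 2 * (x ^ 2 + 1) * (4 * s ^ 2 + 8 * d * Real.exp (-x ^ 2 / 2))) := by
  classical
  set S : Finset (Fin d) := Finset.univ.filter fun j => θ j ≠ 0 with hS
  have hcard : S.card ≤ s := hθ
  have hcard' : (S.card : ℝ) ≤ s := by exact_mod_cast hcard
  let X : Fin d → ℝ → ℝ := fun j u => if j ∈ S then 0 else σ * (if x < |u| then u else 0)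
  have hterm : ∀ (y : Fin d → ℝ) j, j ∉ S →
      (if σ * x < |θ j + σ * y j| then θ j + σ * y j else 0) - θ j = X j (y j) := by
    intro y j hj
    have h0 : θ j = 0 := by simpa [hS] using hj
    simp only [X, if_neg hj, h0, zero_add, sub_zero, abs_mul, abs_of_pos hσ,
      mul_lt_mul_iff_right₀ hσ]
    split_ifs <;> simp
  -- The error splits into support and noise parts via `(A + B)² ≤ 2 A² + 2 B²`; Cauchy–Schwarz on
  -- the support gives a factor `s`, and summing over `S` later gives another.
  have hpt : ∀ y : Fin d → ℝ, ENNReal.ofReal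
      (((∑ j, if σ * x < |θ j + σ * y j| then θ j + σ * y j else 0) - linFun θ) ^ 2) ≤
      ENNReal.ofReal (2 * σ ^ 2 * s) * ∑ j ∈ S, ENNReal.ofReal (2 * (x ^ 2 + (y j) ^ 2)) +
        2 * ENNReal.ofReal ((∑ j, X j (y j)) ^ 2) := by
    intro y
    rw [← ENNReal.ofReal_sum_of_nonneg fun j _ => by positivity,
      show (2 : ℝ≥0∞) = ENNReal.ofReal 2 by norm_num, ← ENNReal.ofReal_mul (by positivity),
      ← ENNReal.ofReal_mul (by positivity), ← ENNReal.ofReal_add ?_ (by positivity)]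
    swap
    · exact mul_nonneg (by positivity) (Finset.sum_nonneg fun j _ => by positivity)
    refine ENNReal.ofReal_le_ofReal ?_
    set A : Fin d → ℝ := fun j =>
      (if σ * x < |θ j + σ * y j| then θ j + σ * y j else 0) - θ j with hA
    have h1 : (∑ j, if σ * x < |θ j + σ * y j| then θ j + σ * y j else 0) - linFun θ =
        ∑ j ∈ S, A j + ∑ j, X j (y j) := by
      rw [linFun, ← Finset.sum_sub_distrib, ← Finset.sum_add_sum_compl S,
        ← Finset.sum_add_sum_compl S fun j => X j (y j),
        Finset.sum_eq_zero (s := S) (f := fun j => X j (y j)) fun j hj => by simp [X, hj],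
        zero_add]
      congr 1
      exact Finset.sum_congr rfl fun j hj => hterm y j (Finset.mem_compl.1 hj)
    have h2 : (∑ j ∈ S, A j) ^ 2 ≤ σ ^ 2 * s * ∑ j ∈ S, 2 * (x ^ 2 + (y j) ^ 2) := by
      calc (∑ j ∈ S, A j) ^ 2 ≤ S.card * ∑ j ∈ S, A j ^ 2 := sq_sum_le_card_mul_sum_sq
        _ ≤ s * ∑ j ∈ S, σ ^ 2 * (2 * (x ^ 2 + (y j) ^ 2)) := by
            gcongr with j hj
            refine (sq_hardThreshold_sub_le _ _ _ _).trans (le_of_eq ?_)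
            ring
        _ = _ := by rw [← Finset.mul_sum]; ring
    rw [h1]
    nlinarith [sq_nonneg (∑ j ∈ S, A j - ∑ j, X j (y j))]
  have hcoord : ∀ j : Fin d, ∫⁻ y : Fin d → ℝ, ENNReal.ofReal (2 * (x ^ 2 + (y j) ^ 2))
      ∂(stdGaussianPi (Fin d)) = ENNReal.ofReal (2 * (x ^ 2 + 1)) := fun j => by
    rw [← lintegral_const_add_sq_gaussianReal]
    exact (measurePreserving_eval (fun _ : Fin d => gaussianReal 0 1) j).lintegral_comp
      (f := fun u => ENNReal.ofReal (2 * (x ^ 2 + u ^ 2))) (by fun_prop)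
  have hXsum : ∫⁻ y, ENNReal.ofReal ((∑ j, X j (y j)) ^ 2) ∂(stdGaussianPi (Fin d)) ≤
      ENNReal.ofReal (d * (σ ^ 2 * (4 * (x ^ 2 + 1) * Real.exp (-x ^ 2 / 2)))) := by
    rw [lintegral_sum_sq_pi (μ := fun _ => gaussianReal 0 1)]
    · calc _ ≤ ∑ _j : Fin d,
            ENNReal.ofReal (σ ^ 2 * (4 * (x ^ 2 + 1) * Real.exp (-x ^ 2 / 2))) := by
            refine Finset.sum_le_sum fun j _ => ?_
            rw [ENNReal.ofReal_mul (sq_nonneg σ)]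
            refine le_trans ?_ (mul_le_mul_right (lintegral_sq_tail_gaussianReal_le hx) _)
            rw [← lintegral_const_mul' _ _ ENNReal.ofReal_ne_top]
            refine lintegral_mono fun u => ?_
            rw [← ENNReal.ofReal_mul (sq_nonneg σ)]
            refine ENNReal.ofReal_le_ofReal ?_
            simp only [X]
            by_cases hj : j ∈ S
            · rw [if_pos hj, zero_pow two_ne_zero]
              split_ifs <;> positivity
            · rw [if_neg hj, mul_pow]
              split_ifs <;> simp
        _ = _ := by
            rw [Finset.sum_const, nsmul_eq_mul, Finset.card_univ, Fintype.card_fin,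
              ← ENNReal.ofReal_natCast, ← ENNReal.ofReal_mul (by positivity)]
    · intro j
      simp only [X]
      split_ifs
      · exact MemLp.zero
      · exact (memLp_hardThreshold_gaussianReal x).const_mul σ
    · intro j
      simp only [X]
      split_ifs
      · simp
      · rw [integral_const_mul, integral_hardThreshold_gaussianReal, mul_zero]
  have hm : Measurable fun y : Fin d → ℝ => ENNReal.ofReal
      (((∑ j, if σ * x < |y j| then y j else 0) - linFun θ) ^ 2) := by
    refine (((Finset.measurable_fun_sum _ fun j _ => Measurable.ite ?_ (by fun_prop)
      measurable_const).sub_const _).pow_const 2).ennreal_ofReal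
    exact measurableSet_lt measurable_const (by fun_prop)
  rw [lintegral_obsLaw _ _ hm]
  refine (lintegral_mono hpt).trans ?_
  rw [lintegral_add_left (by fun_prop), lintegral_const_mul _ (by fun_prop),
    lintegral_finsetSum _ fun j _ => by fun_prop,
    lintegral_const_mul' _ _ ENNReal.ofNat_ne_top]
  simp_rw [hcoord]
  rw [Finset.sum_const, nsmul_eq_mul, ← ENNReal.ofReal_natCast,
    ← ENNReal.ofReal_mul (by positivity), ← ENNReal.ofReal_mul (by positivity)]
  refine (add_le_add le_rfl (mul_le_mul_right hXsum 2)).trans ?_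
  rw [show (2 : ℝ≥0∞) = ENNReal.ofReal 2 by norm_num, ← ENNReal.ofReal_mul (by positivity),
    ← ENNReal.ofReal_add (by positivity) (by positivity)]
  refine ENNReal.ofReal_le_ofReal ?_
  have h3 : (s : ℝ) * S.card ≤ s * s := by gcongr
  nlinarith [mul_le_mul_of_nonneg_left h3 (show 0 ≤ 4 * (σ ^ 2 * (x ^ 2 + 1)) by positivity)]

lemma maxRisk_linEstimator_sparse {s d : ℕ} {σ : ℝ} (hs : 1 ≤ s) (hσ : 0 < σ)
    (hsd : (s : ℝ) < √(d : ℝ)) :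
    maxRisk σ linFun (sparseClass d s) (linEstimator σ s) ≤
      ENNReal.ofReal (48 * linRate σ s d) := by
  have hs0 : (0 : ℝ) < s := by exact_mod_cast hs
  have hd : (s : ℝ) ^ 2 < d := (Real.lt_sqrt hs0.le).1 hsd
  refine iSup₂_le fun θ hθ => ?_
  have hE : ∀ y : Fin d → ℝ, linEstimator σ s y =
      ∑ j, if σ * √(2 * Real.log (1 + (d : ℝ) / (s : ℝ) ^ 2)) < |y j| then y j else 0 := fun y => by
    rw [linEstimator, if_pos hsd]
  simp_rw [hE]
  refine (lintegral_hardThreshold_sum_le hσ (Real.sqrt_nonneg _) hθ).trans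
    (ENNReal.ofReal_le_ofReal ?_)
  set l := Real.log (1 + (d : ℝ) / (s : ℝ) ^ 2) with hl
  have hratio : 1 ≤ (d : ℝ) / (s : ℝ) ^ 2 := by
    rw [le_div_iff₀ (by positivity)]
    linarith
  -- Sparsity gives `l ≥ log 2 > 1/2`, so the additive `1` in `x² + 1` is absorbed into `2 l`.
  have hl2 : 1 ≤ 2 * l := by
    have h1 : Real.log 2 ≤ l := Real.log_le_log (by norm_num) (by linarith)
    linarith [Real.log_two_gt_d9]
  rw [Real.sq_sqrt (by linarith)]
  have hexp : Real.exp (-(2 * l) / 2) = (1 + (d : ℝ) / (s : ℝ) ^ 2)⁻¹ := by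
    rw [show -(2 * l) / 2 = -l by ring, Real.exp_neg, hl, Real.exp_log (by positivity)]
  -- The threshold makes the left side `d s² / (s² + d)`, so the noise term is no larger than the
  -- order of the support term.
  have hde : (d : ℝ) * Real.exp (-(2 * l) / 2) ≤ (s : ℝ) ^ 2 := by
    rw [hexp, mul_inv_le_iff₀ (by positivity)]
    field_simp
    nlinarith
  calc σ ^ 2 * (2 * l + 1) * (4 * s ^ 2 + 8 * d * Real.exp (-(2 * l) / 2))
      ≤ σ ^ 2 * (2 * l + 2 * l) * (4 * s ^ 2 + 8 * (s : ℝ) ^ 2) := by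
        rw [mul_assoc 8]
        gcongr
    _ = 48 * linRate σ s d := by
        rw [linRate, ← hl]
        ring

lemma maxRisk_linEstimator_le {s d : ℕ} {σ : ℝ} (hs : 1 ≤ s) (hσ : 0 < σ) :
    maxRisk σ linFun (sparseClass d s) (linEstimator σ s) ≤
      ENNReal.ofReal (48 * linRate σ s d) := by
  by_cases hsd : (s : ℝ) < √(d : ℝ)
  · exact maxRisk_linEstimator_sparse hs hσ hsd
  · refine (maxRisk_linEstimator_dense hs hsd _).trans (ENNReal.ofReal_le_ofReal ?_)
    linarith [linRate_nonneg σ s d]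

end SparseSequence

theorem theorem1 :
    ∃ c C : ℝ, 0 < c ∧ 0 < C ∧ ∀ (s d : ℕ) (σ : ℝ), 1 ≤ s → s ≤ d → 0 < σ →
      -- the estimator attains the rate
      Measurable (SparseSequence.linEstimator (d := d) σ s) ∧
      SparseSequence.maxRisk σ SparseSequence.linFun (SparseSequence.sparseClass d s)
          (SparseSequence.linEstimator σ s)
        ≤ ENNReal.ofReal (C * SparseSequence.linRate σ s d) ∧
      -- the minimax risk is of the order of the rate
      ENNReal.ofReal (c * SparseSequence.linRate σ s d)
        ≤ SparseSequence.minimaxSqRisk σ SparseSequence.linFun (SparseSequence.sparseClass d s) ∧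
      SparseSequence.minimaxSqRisk σ SparseSequence.linFun (SparseSequence.sparseClass d s)
        ≤ ENNReal.ofReal (C * SparseSequence.linRate σ s d) ∧
      -- equivalent form of the rate
      c * min (SparseSequence.linRate σ s d) (σ ^ 2 * (d : ℝ)) ≤ SparseSequence.linRate σ s d ∧
      SparseSequence.linRate σ s d
        ≤ C * min (SparseSequence.linRate σ s d) (σ ^ 2 * (d : ℝ)) ∧
      ENNReal.ofReal (c * min (SparseSequence.linRate σ s d) (σ ^ 2 * (d : ℝ)))
        ≤ SparseSequence.minimaxSqRisk σ SparseSequence.linFun (SparseSequence.sparseClass d s) ∧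
      SparseSequence.minimaxSqRisk σ SparseSequence.linFun (SparseSequence.sparseClass d s)
        ≤ ENNReal.ofReal (C * min (SparseSequence.linRate σ s d) (σ ^ 2 * (d : ℝ))) := by
  -- `1 / 20` comes from the two-hypotheses bound; `48 = 4 * (4 + 8)` comes from thresholding and
  -- covers the constant `2` of the dense regime.
  refine ⟨1 / 20, 48, by norm_num, by norm_num, fun s d σ hs hsd hσ => ?_⟩
  have hmin : min (SparseSequence.linRate σ s d) (σ ^ 2 * (d : ℝ)) =
      SparseSequence.linRate σ s d := min_eq_left (SparseSequence.linRate_le σ hs)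
  have hnn := SparseSequence.linRate_nonneg σ s d
  have hmeas := SparseSequence.measurable_linEstimator (d := d) σ s
  have hup := SparseSequence.maxRisk_linEstimator_le (d := d) hs hσ
  have hup' : SparseSequence.minimaxSqRisk σ SparseSequence.linFun
      (SparseSequence.sparseClass d s) ≤ ENNReal.ofReal (48 * SparseSequence.linRate σ s d) :=
    (iInf₂_le _ hmeas).trans hup
  have hlow := SparseSequence.linRate_div_le_minimaxSqRisk σ hs hsd
  rw [div_eq_inv_mul, ← one_div] at hlow
  rw [hmin]
  exact ⟨hmeas, hup, hlow, hup', by linarith, by linarith, hlow, hup'⟩
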